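/- Let $d\ge 1$ and let $n_0,\dots,n_d\ge 1$ be layer widths, $n_0$ being the input dimension and $K=n_d\ge 2$ the number of classes. For $W=(W^1,\dots,W^d)$ with $W^j\in\mathbb R^{n_{j-1}\times n_j}$ let $f_W:\mathbb R^{n_0}\to\mathbb R^{K}$ be the ReLU network $f_W(x)=x^d$, $x^0=x$, $x^j=\max\{(W^j)^{\mathsf T}x^{j-1},0\}$ (entrywise). A vector $w\in\mathbb R^k$ is effectively $\bar s$-sparse, $\bar s\in[1,k]$, if $(\sum_i|w_i|^{1/2})^2\le\bar s\,\|w\|_1$; a matrix $A\in\mathbb R^{k\times l}$ with columns $a_1,\dots,a_l$ is effectively joint $\bar s$-sparse, $\bar s\in[1,l]$, if $\sum_i\|a_i\|_1\le\bar s\,\|A\|_{1,\infty}$, where $\|A\|_{1,\infty}=\max_i\|a_i\|_1$. For $\varepsilon\ge0$ let $$\ell_\varepsilon(f;x,y)=\inf_{\|\eta\|_\infty\le\varepsilon}\Big([f(x+\eta)]_y-\max_{j\ne y}[f(x+\eta)]_j\Big),$$ $L_\gamma^\varepsilon(f)=\mathbb P_{(x,y)\sim\mathcal D}[\ell_\varepsilon(f;x,y)\le\gamma]$,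 and, for a sample $S=((x_1,y_1),\dots,(x_m,y_m))$, $\widehat L_\gamma^\varepsilon(f)=\frac1m\#\{i:\ell_\varepsilon(f;x_i,y_i)\le\gamma\}$. There is a universal constant $C>0$ such that the following holds for all such widths, all $\bar s_1^j,\bar s_2^j$ ($j=1,\dots,d$), all $\gamma>0$ and all $0\le\varepsilon<\gamma/4$. Let $\mathcal W$ be the set of all $W$ such that, for every $j$, $\|W^j\|_{1,\infty}=1$, the columns of $W^j$ are effectively $\bar s_1^j$-sparse, and $W^j$ is effectively joint $\bar s_2^j$-sparse. Put $$T=d\,\Big(\frac{1+\gamma/2-\varepsilon}{\gamma/2-2\varepsilon}\Big)^2\Big(\sum_{j=1}^d\sqrt{\bar s_1^j\bar s_2^j}\Big)^2,\qquad \Lambda=\log\big(2+T\max_{0\le j\le d}n_j\big).$$ Then there are a finite set $\mathcal G$ of networks $f_{\widehat W}$ with the same layer widths and a compression map $W\mapsto\widehat W$ with $f_{\widehat W}\in\mathcal G$ and $|\ell_\varepsilon(f_W;x,y)-\ell_\varepsilon(f_{\widehat W};x,y)|\le\gamma$ for all $W\in\mathcal W$, $\|x\|_\infty\le1$ and $y\in\{1,\dots,K\}$,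 both depending only on the widths, the $\bar s_1^j,\bar s_2^j$, $\gamma$ and $\varepsilon$, such that for every probability measure $\mathcal D$ on $\mathbb R^{n_0}\times\{1,\dots,K\}$ with $\|x\|_\infty\le1$ almost surely, every $m\ge1$ and every $\delta\in(0,1)$, with probability at least $1-\delta$ over $m$ independent samples from $\mathcal D$, simultaneously for all $W\in\mathcal W$, $$L_0^\varepsilon(f_{\widehat W})\le\widehat L_\gamma^\varepsilon(f_W)+C\sqrt{\frac{T\,\Lambda}{m}}+\sqrt{\frac{\log(1/\delta)}{m}}.$$ In particular the bound depends on the widths, hence on the input dimension and on the number of classes, only through the logarithmic factor $\Lambda$ (and through the sparsity levels). -/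

import Mathlib

open MeasureTheory

noncomputable section

namespace AdvNet

/-- The `ℓ₁`-norm of a real vector. -/
def l1Norm {k : ℕ} (w : Fin k → ℝ) : ℝ := ∑ i, |w i|

/-- The `ℓ_{1/2}`-quasinorm `(∑ᵢ |wᵢ|^{1/2})²` of a real vector. -/
def lHalfNorm {k : ℕ} (w : Fin k → ℝ) : ℝ := (∑ i, √|w i|) ^ 2

/-- The mixed norm `‖A‖_{1,∞}`: the largest `ℓ₁`-norm of a column. -/
def norm1Inf {k l : ℕ} (A : Matrix (Fin k) (Fin l) ℝ) : ℝ := ⨆ j, l1Norm (A.col j)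

/-- The mixed norm `‖A‖_{1,1}`: the sum of the `ℓ₁`-norms of the columns. -/
def norm11 {k l : ℕ} (A : Matrix (Fin k) (Fin l) ℝ) : ℝ := ∑ j, l1Norm (A.col j)

/-- A vector `w ∈ ℝᵏ` is effectively `s`-sparse, with `s ∈ [1, k]`. -/
def EffSparse {k : ℕ} (s : ℝ) (w : Fin k → ℝ) : Prop :=
  s ∈ Set.Icc (1 : ℝ) k ∧ lHalfNorm w ≤ s * l1Norm w

/-- A matrix `A ∈ ℝ^{k × l}` is effectively joint `s`-sparse, with `s ∈ [1, l]`. -/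
def EffJointSparse {k l : ℕ} (s : ℝ) (A : Matrix (Fin k) (Fin l) ℝ) : Prop :=
  s ∈ Set.Icc (1 : ℝ) l ∧ norm11 A ≤ s * norm1Inf A

/-- The weights of a fully connected `d`-layer network with layer widths `n 0, …, n d`. The
`j`-th matrix has one column for each neuron of the `j`-th layer. -/
abbrev Weights {d : ℕ} (n : Fin (d + 1) → ℕ) : Type :=
  (j : Fin d) → Matrix (Fin (n j.castSucc)) (Fin (n j.succ)) ℝ

/-- The ReLU activation, applied entrywise. -/
def relu {k : ℕ} (v : Fin k → ℝ) : Fin k → ℝ := fun i => max (v i) 0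

/-- The value `xⁱ` of the `i`-th layer: `x⁰ = x` and `xʲ = relu ((Wʲ)ᵀ xʲ⁻¹)`. -/
def layer {d : ℕ} {n : Fin (d + 1) → ℕ} (W : Weights n) (x : Fin (n 0) → ℝ)
    (i : Fin (d + 1)) : Fin (n i) → ℝ :=
  Fin.induction (motive := fun i => Fin (n i) → ℝ) x
    (fun j v => relu ((W j).transpose.mulVec v)) i

/-- The score function `f_W(x) = xᵈ` of the network. -/
def network {d : ℕ} {n : Fin (d + 1) → ℕ} (W : Weights n) (x : Fin (n 0) → ℝ) :
    Fin (n (Fin.last d)) → ℝ :=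
  layer W x (Fin.last d)

/-- The networks under consideration: every weight matrix has `‖Wʲ‖_{1,∞} = 1`, effectively
`s₁ j`-sparse columns, and is effectively joint `s₂ j`-sparse. -/
def Admissible {d : ℕ} {n : Fin (d + 1) → ℕ} (s₁ s₂ : Fin d → ℝ) (W : Weights n) : Prop :=
  ∀ j, norm1Inf (W j) = 1 ∧ (∀ i, EffSparse (s₁ j) ((W j).col i)) ∧ EffJointSparse (s₂ j) (W j)

/-- The classification margin `f(x)_y - max_{j ≠ y} f(x)_j`. -/
def margin {k K : ℕ} (f : (Fin k → ℝ) → Fin K → ℝ) (x : Fin k → ℝ) (y : Fin K) : ℝ :=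
  f x y - ⨆ j : {j : Fin K // j ≠ y}, f x j

/-- The margin under adversarial perturbations of `ℓ_∞`-norm at most `ε`
(the norm of `Fin k → ℝ` is the `ℓ_∞`-norm). -/
def advMargin {k K : ℕ} (ε : ℝ) (f : (Fin k → ℝ) → Fin K → ℝ) (x : Fin k → ℝ) (y : Fin K) : ℝ :=
  ⨅ η : {η : Fin k → ℝ // ‖η‖ ≤ ε}, margin f (x + η) y

/-- The adversarial margin loss `L_γ^ε(f) = ℙ[ℓ_ε(f; x, y) ≤ γ]` under the distribution `D`. -/
def advLoss {k K : ℕ} (D : Measure ((Fin k → ℝ) × Fin K)) (γ ε : ℝ)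
    (f : (Fin k → ℝ) → Fin K → ℝ) : ℝ :=
  D.real {z | advMargin ε f z.1 z.2 ≤ γ}

/-- The empirical adversarial margin loss on a sample `S` of size `m`. -/
def empAdvLoss {k K m : ℕ} (S : Fin m → (Fin k → ℝ) × Fin K) (γ ε : ℝ)
    (f : (Fin k → ℝ) → Fin K → ℝ) : ℝ :=
  (1 / (m : ℝ)) * ∑ i, Set.indicator {z | advMargin ε f z.1 z.2 ≤ γ} (fun _ => (1 : ℝ)) (S i)

/-- The capacity `d ((1 + γ/2 - ε) / (γ/2 - 2ε))² (∑ⱼ √(s₁ʲ s₂ʲ))²`. -/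
def capacity {d : ℕ} (s₁ s₂ : Fin d → ℝ) (γ ε : ℝ) : ℝ :=
  d * ((1 + γ / 2 - ε) / (γ / 2 - 2 * ε)) ^ 2 * (∑ j, √(s₁ j * s₂ j)) ^ 2

/-- The largest layer width, the input dimension and the number of classes included. -/
def maxWidth {d : ℕ} (n : Fin (d + 1) → ℕ) : ℕ := Finset.univ.sup n

/-- The logarithmic factor that the notation `Õ` suppresses. -/
def logFactor {d : ℕ} (n : Fin (d + 1) → ℕ) (s₁ s₂ : Fin d → ℝ) (γ ε : ℝ) : ℝ :=
  Real.log (2 + maxWidth n * capacity s₁ s₂ γ ε)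

end AdvNet

end

/-! Truncate every weight towards zero to a multiple of a scale `θ j`. In units of `θ j` an entry
`a` moves by at most `√|a|`, so the `ℓ₁` error of a column is governed by its `ℓ_{1/2}` quasinorm,
hence by `√(θ j * s₁ j)`. Column norms do not grow, so layers stay nonexpansive in the sup norm and
layer errors simply add (`norm_network_sub_network_le`).

Write `R` for the quotient in the capacity and `σ = ∑ √(s₁ j * s₂ j)`. With `θ j = s₂ j / (R * σ) ^
2` the errors sum to `1 / R`, and margins move by at most `2 * (1 + ε) / R ≤ γ`. Joint sparsity
bounds the `ℓ₁` norm of each integer matrix by `(R * σ) ^ 2`, so it is a sum of that many signed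
units. The compressed class thus has log-cardinality at most `3 * T * Λ`
(`card_gridWeights_le_exp`); Hoeffding's inequality and a union bound finish. -/

open ProbabilityTheory

/-! ### Integer truncation and integer vectors of bounded `ℓ₁` norm. -/

/-- Truncation towards zero moves a real number by at most the square root of its size. -/
theorem exists_int_abs_le_abs_sub_le_sqrt (x : ℝ) :
    ∃ z : ℤ, |(z : ℝ)| ≤ |x| ∧ |x - z| ≤ √|x| := by
  have key : ∀ x : ℝ, 0 ≤ x → |((⌊x⌋ : ℤ) : ℝ)| ≤ |x| ∧ |x - (⌊x⌋ : ℤ)| ≤ √|x| := by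
    intro x hx
    have h0 : (0 : ℝ) ≤ ⌊x⌋ := by exact_mod_cast Int.floor_nonneg.2 hx
    have h1 := Int.floor_le x
    have h2 := Int.lt_floor_add_one x
    rw [abs_of_nonneg h0, abs_of_nonneg hx, abs_of_nonneg (by linarith)]
    refine ⟨h1, Real.le_sqrt_of_sq_le ?_⟩
    -- The fractional part `t` satisfies `t² ≤ t ≤ x`.
    nlinarith
  rcases le_total 0 x with hx | hx
  · exact ⟨_, key x hx⟩
  · obtain ⟨h1, h2⟩ := key (-x) (by linarith)
    refine ⟨-⌊-x⌋, ?_, ?_⟩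
    · push_cast
      rwa [abs_neg, ← abs_neg x]
    · push_cast
      rw [← abs_neg, ← abs_neg x]
      convert h2 using 2
      ring

/-- The signed unit vectors and zero, as an alphabet for integer vectors. -/
def signedUnit {κ : Type*} [DecidableEq κ] : Option (κ × Bool) → κ → ℤ
  | none => 0
  | some (k, b) => Pi.single k (if b then 1 else -1)

/-- An integer vector of `ℓ₁`-norm at most `M` is a sum of `M` signed unit vectors or zeros. -/
theorem exists_sum_signedUnit_eq {κ : Type*} [Fintype κ] [DecidableEq κ] (M : ℕ) (z : κ → ℤ)
    (hz : ∑ k, |z k| ≤ M) : ∃ w : Fin M → Option (κ × Bool), ∑ t, signedUnit (w t) = z := by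
  induction M generalizing z with
  | zero =>
    refine ⟨Fin.elim0, ?_⟩
    have h := (Finset.sum_eq_zero_iff_of_nonneg (fun k _ => abs_nonneg (z k))).1
      (le_antisymm (by simpa using hz) (Finset.sum_nonneg fun k _ => abs_nonneg (z k)))
    ext k
    exact (abs_eq_zero.1 (h k (Finset.mem_univ k))).symm
  | succ M ih =>
    by_cases h0 : z = 0
    · exact ⟨fun _ => none, by simp [signedUnit, h0]⟩
    · obtain ⟨k, hk⟩ := Function.ne_iff.1 h0
      obtain ⟨b, hb⟩ : ∃ b : Bool, |z k - (if b then 1 else -1)| = |z k| - 1 := by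
        rcases lt_or_gt_of_ne hk with h | h
        · refine ⟨false, ?_⟩
          simp only [Pi.zero_apply] at h
          simp only [Bool.false_eq_true, if_false]
          rw [abs_of_neg h, abs_of_nonpos (by omega)]
          omega
        · refine ⟨true, ?_⟩
          simp only [Pi.zero_apply] at h
          simp only [if_true]
          rw [abs_of_pos h, abs_of_nonneg (by omega)]
      obtain ⟨w, hw⟩ := ih (z - signedUnit (some (k, b))) (by
        rw [← Finset.add_sum_erase _ _ (Finset.mem_univ k)] at hz ⊢
        have : ∑ x ∈ Finset.univ.erase k, |(z - signedUnit (some (k, b))) x| =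
            ∑ x ∈ Finset.univ.erase k, |z x| := by
          refine Finset.sum_congr rfl fun x hx => ?_
          simp [signedUnit, Finset.ne_of_mem_erase hx]
        rw [this]
        simp only [signedUnit, Pi.sub_apply, Pi.single_eq_same, hb]
        push_cast at hz
        linarith)
      refine ⟨Fin.cons (some (k, b)) w, ?_⟩
      rw [Fin.sum_univ_succ]
      simp [hw]

namespace AdvNet

/-! ### Sup-norm stability of the network in its weights. -/

theorem l1Norm_nonneg {k : ℕ} (w : Fin k → ℝ) : 0 ≤ l1Norm w :=
  Finset.sum_nonneg fun _ _ => abs_nonneg _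

theorem l1Norm_col_le_norm1Inf {k l : ℕ} (A : Matrix (Fin k) (Fin l) ℝ) (i : Fin l) :
    l1Norm (A.col i) ≤ norm1Inf A :=
  le_ciSup (f := fun j => l1Norm (A.col j)) (Set.finite_range _).bddAbove i

theorem abs_relu_sub_relu_le {k : ℕ} (u v : Fin k → ℝ) (i : Fin k) :
    |relu u i - relu v i| ≤ |u i - v i| :=
  abs_max_sub_max_le_abs _ _ _

theorem relu_zero {k : ℕ} : relu (0 : Fin k → ℝ) = 0 := by
  ext i
  simp [relu]

theorem abs_transpose_mulVec_le {k l : ℕ} (A : Matrix (Fin k) (Fin l) ℝ) (v : Fin k → ℝ)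
    (i : Fin l) : |A.transpose.mulVec v i| ≤ l1Norm (A.col i) * ‖v‖ := by
  simp only [Matrix.mulVec, dotProduct, Matrix.transpose_apply, l1Norm, Matrix.col_apply,
    Finset.sum_mul]
  refine (Finset.abs_sum_le_sum_abs _ _).trans (Finset.sum_le_sum fun a _ => ?_)
  rw [abs_mul]
  exact mul_le_mul_of_nonneg_left (norm_le_pi_norm v a) (abs_nonneg _)

theorem layer_zero {d : ℕ} {n : Fin (d + 1) → ℕ} (W : Weights n) (x : Fin (n 0) → ℝ) :
    layer W x 0 = x := rfl

theorem layer_succ {d : ℕ} {n : Fin (d + 1) → ℕ} (W : Weights n) (x : Fin (n 0) → ℝ)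
    (j : Fin d) : layer W x j.succ = relu ((W j).transpose.mulVec (layer W x j.castSucc)) := rfl

theorem continuous_network {d : ℕ} {n : Fin (d + 1) → ℕ} (W : Weights n) :
    Continuous (network W) := by
  have : ∀ i, Continuous fun x => layer W x i := by
    intro i
    induction i using Fin.induction with
    | zero => simp only [layer_zero]; exact continuous_id
    | succ j ih =>
      simp only [layer_succ]
      refine continuous_pi fun a => ?_
      have : Continuous fun x => (W j).transpose.mulVec (layer W x j.castSucc) :=
        Continuous.matrix_mulVec continuous_const ih
      exact ((continuous_apply a).comp this).max continuous_const
  exact this _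

theorem norm_layer_le {d : ℕ} {n : Fin (d + 1) → ℕ} {W : Weights n}
    (hW : ∀ j i, l1Norm ((W j).col i) ≤ 1) (x : Fin (n 0) → ℝ) (i : Fin (d + 1)) :
    ‖layer W x i‖ ≤ ‖x‖ := by
  induction i using Fin.induction with
  | zero => rw [layer_zero]
  | succ j ih =>
    rw [layer_succ]
    refine (pi_norm_le_iff_of_nonneg (norm_nonneg _)).2 fun a => ?_
    have h1 := abs_relu_sub_relu_le ((W j).transpose.mulVec (layer W x j.castSucc)) 0 a
    simp only [relu_zero, Pi.zero_apply, sub_zero] at h1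
    refine h1.trans ((abs_transpose_mulVec_le _ _ _).trans ?_)
    exact (mul_le_mul (hW j a) ih (norm_nonneg _) zero_le_one).trans (one_mul _).le

/-- Perturbing the weights layer by layer perturbs the scores by the sum of the perturbations. -/
theorem norm_network_sub_network_le {d : ℕ} {n : Fin (d + 1) → ℕ} {W V : Weights n}
    (hW : ∀ j i, l1Norm ((W j).col i) ≤ 1) (hV : ∀ j i, l1Norm ((V j).col i) ≤ 1)
    {τ : Fin d → ℝ} (hτ : ∀ j i, l1Norm ((W j - V j).col i) ≤ τ j) (hτ0 : ∀ j, 0 ≤ τ j)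
    (x : Fin (n 0) → ℝ) : ‖network W x - network V x‖ ≤ ‖x‖ * ∑ j, τ j := by
  have key : ∀ i : Fin (d + 1), ‖layer W x i - layer V x i‖ ≤
      ‖x‖ * ∑ j, if j.castSucc < i then τ j else 0 := by
    intro i
    induction i using Fin.induction with
    | zero => simp [layer_zero]
    | succ j ih =>
      have hsum : (∑ k, if k.castSucc < j.succ then τ k else 0) =
          τ j + ∑ k, if k.castSucc < j.castSucc then τ k else 0 := by
        rw [← Finset.add_sum_erase _ _ (Finset.mem_univ j),
          ← Finset.add_sum_erase _ (fun k => if k.castSucc < j.castSucc then τ k else 0)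
            (Finset.mem_univ j)]
        simp only [Fin.castSucc_lt_succ, if_true, lt_irrefl, if_false, zero_add]
        congr 1
        refine Finset.sum_congr rfl fun k hk => ?_
        have hne := Finset.ne_of_mem_erase hk
        congr 1
        simp only [Fin.castSucc_lt_succ_iff, Fin.castSucc_lt_castSucc_iff, eq_iff_iff]
        exact ⟨fun h => lt_of_le_of_ne h hne, le_of_lt⟩
      have hs0 : 0 ≤ ∑ k, if k.castSucc < j.succ then τ k else 0 :=
        Finset.sum_nonneg fun k _ => by split_ifs <;> simp [hτ0]
      rw [layer_succ, layer_succ]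
      refine (pi_norm_le_iff_of_nonneg (mul_nonneg (norm_nonneg _) hs0)).2 fun a => ?_
      have h1 := abs_relu_sub_relu_le ((W j).transpose.mulVec (layer W x j.castSucc))
        ((V j).transpose.mulVec (layer V x j.castSucc)) a
      refine h1.trans ?_
      -- The new error meets a layer value of norm at most `‖x‖`; the inherited one passes through a
      -- nonexpansive matrix.
      have h2 : (W j).transpose.mulVec (layer W x j.castSucc) a -
          (V j).transpose.mulVec (layer V x j.castSucc) a =
          (W j - V j).transpose.mulVec (layer W x j.castSucc) a +
          (V j).transpose.mulVec (layer W x j.castSucc - layer V x j.castSucc) a := by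
        rw [Matrix.transpose_sub, Matrix.sub_mulVec, Matrix.mulVec_sub]
        simp
      rw [h2, hsum, mul_add]
      refine (abs_add_le _ _).trans (add_le_add ?_ ?_)
      · refine (abs_transpose_mulVec_le _ _ _).trans ?_
        rw [mul_comm]
        exact mul_le_mul (norm_layer_le hW x _) (hτ j a) (l1Norm_nonneg _) (norm_nonneg _)
      · refine (abs_transpose_mulVec_le _ _ _).trans ?_
        exact (mul_le_mul (hV j a) ih (norm_nonneg _) zero_le_one).trans (one_mul _).le
  simpa [network, Fin.castSucc_lt_last] using key (Fin.last d)

/-! ### Stability and measurability of margins. -/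

/-- The score at `y` and the maximum of the others are each 1-Lipschitz in the sup norm. Taking `f =
g` yields continuity, taking `x = x'` the compression error. -/
theorem abs_margin_sub_margin_le {k K : ℕ} (hK : 2 ≤ K) (f g : (Fin k → ℝ) → Fin K → ℝ)
    (x x' : Fin k → ℝ) (y : Fin K) : |margin f x y - margin g x' y| ≤ 2 * ‖f x - g x'‖ := by
  have : Nonempty {j : Fin K // j ≠ y} := by
    have : Nontrivial (Fin K) := Fin.nontrivial_iff_two_le.2 hK
    obtain ⟨j, hj⟩ := exists_ne y
    exact ⟨⟨j, hj⟩⟩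
  have key : ∀ u v : Fin K → ℝ,
      (⨆ j : {j : Fin K // j ≠ y}, u j) ≤ (⨆ j : {j : Fin K // j ≠ y}, v j) + ‖u - v‖ := by
    intro u v
    refine ciSup_le fun j => ?_
    have h1 : v j ≤ ⨆ j : {j : Fin K // j ≠ y}, v j :=
      le_ciSup (f := fun j : {j : Fin K // j ≠ y} => v j) (Set.finite_range _).bddAbove j
    have h2 := (le_abs_self _).trans (norm_le_pi_norm (u - v) j)
    simp only [Pi.sub_apply] at h2
    linarith
  have h1 := key (f x) (g x')
  have h2 := key (g x') (f x)
  have h3 := abs_le.1 (norm_le_pi_norm (f x - g x') y)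
  rw [norm_sub_rev (g x')] at h2
  simp only [Pi.sub_apply] at h3
  unfold margin
  rw [abs_le]
  constructor <;> linarith [h3.1, h3.2]

theorem continuous_margin {k K : ℕ} (hK : 2 ≤ K) {f : (Fin k → ℝ) → Fin K → ℝ}
    (hf : Continuous f) (y : Fin K) : Continuous fun x => margin f x y := by
  refine continuous_iff_continuousAt.2 fun x => ?_
  rw [ContinuousAt, tendsto_iff_dist_tendsto_zero]
  refine squeeze_zero (fun _ => dist_nonneg) (fun x' => abs_margin_sub_margin_le hK f f x' x y) ?_
  have h := (tendsto_iff_norm_sub_tendsto_zero.1 (hf.tendsto x)).const_mul 2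
  simpa using h

theorem bddBelow_margin {k K : ℕ} (hK : 2 ≤ K) {f : (Fin k → ℝ) → Fin K → ℝ}
    (hf : Continuous f) (ε : ℝ) (x : Fin k → ℝ) (y : Fin K) :
    BddBelow (Set.range fun η : {η : Fin k → ℝ // ‖η‖ ≤ ε} => margin f (x + η) y) := by
  have hc : IsCompact {η : Fin k → ℝ | ‖η‖ ≤ ε} := by
    have h0 : {η : Fin k → ℝ | ‖η‖ ≤ ε} = Metric.closedBall 0 ε := by
      ext η
      simp
    exact h0 ▸ isCompact_closedBall _ _
  have h : Continuous fun η => margin f (x + η) y :=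
    (continuous_margin hK hf y).comp (continuous_const.add continuous_id)
  refine (hc.bddBelow_image h.continuousOn).mono ?_
  rintro _ ⟨η, rfl⟩
  exact ⟨η, η.2, rfl⟩

theorem abs_advMargin_sub_advMargin_le {k K : ℕ} (hK : 2 ≤ K) {f g : (Fin k → ℝ) → Fin K → ℝ}
    (hf : Continuous f) (hg : Continuous g) {ε c : ℝ} (hε : 0 ≤ ε) (x : Fin k → ℝ) (y : Fin K)
    (h : ∀ η : Fin k → ℝ, ‖η‖ ≤ ε → 2 * ‖f (x + η) - g (x + η)‖ ≤ c) :
    |advMargin ε f x y - advMargin ε g x y| ≤ c := by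
  have : Nonempty {η : Fin k → ℝ // ‖η‖ ≤ ε} := ⟨⟨0, by simpa using hε⟩⟩
  have key : ∀ f g : (Fin k → ℝ) → Fin K → ℝ, Continuous f →
      (∀ η : Fin k → ℝ, ‖η‖ ≤ ε → 2 * ‖f (x + η) - g (x + η)‖ ≤ c) →
      advMargin ε f x y - c ≤ advMargin ε g x y := by
    intro f g hf h
    refine le_ciInf fun η => ?_
    have h1 : advMargin ε f x y ≤ margin f (x + η) y := ciInf_le (bddBelow_margin hK hf ε x y) η
    have h2 := abs_le.1 ((abs_margin_sub_margin_le hK f g (x + η) (x + η) y).trans (h η η.2))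
    linarith [h2.2]
  rw [abs_le]
  have h1 := key f g hf h
  have h2 := key g f hg fun η hη => by rw [norm_sub_rev]; exact h η hη
  constructor <;> linarith

/-- For fixed `y`, an infimum of continuous functions is upper semicontinuous, even over uncountably
many `η`; the label is discrete. -/
theorem measurable_advMargin {k K : ℕ} (hK : 2 ≤ K) {f : (Fin k → ℝ) → Fin K → ℝ}
    (hf : Continuous f) (ε : ℝ) :
    Measurable fun z : (Fin k → ℝ) × Fin K => advMargin ε f z.1 z.2 := by
  refine measurable_from_prod_countable_left fun y => ?_
  refine UpperSemicontinuous.measurable ?_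
  exact upperSemicontinuous_ciInf (fun x => bddBelow_margin hK hf ε x y) fun η =>
    ((continuous_margin hK hf y).comp (continuous_id.add continuous_const)).upperSemicontinuous

/-! ### Rounded matrices and the size of the grid. -/

/-- Rounding the entries of a matrix towards zero to multiples of `θ`. -/
noncomputable def roundMatrix {k l : ℕ} (θ : ℝ) (A : Matrix (Fin k) (Fin l) ℝ) (a : Fin k × Fin l) : ℤ :=
  (exists_int_abs_le_abs_sub_le_sqrt (A a.1 a.2 / θ)).choose

theorem mul_abs_roundMatrix_le {k l : ℕ} {θ : ℝ} (hθ : 0 < θ) (A : Matrix (Fin k) (Fin l) ℝ)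
    (a : Fin k × Fin l) : θ * |(roundMatrix θ A a : ℝ)| ≤ |A a.1 a.2| := by
  have h : |(roundMatrix θ A a : ℝ)| ≤ |A a.1 a.2 / θ| :=
    (exists_int_abs_le_abs_sub_le_sqrt (A a.1 a.2 / θ)).choose_spec.1
  rw [abs_div, abs_of_pos hθ, le_div_iff₀ hθ, mul_comm] at h
  exact h

theorem abs_sub_mul_roundMatrix_le {k l : ℕ} {θ : ℝ} (hθ : 0 < θ) (A : Matrix (Fin k) (Fin l) ℝ)
    (a : Fin k × Fin l) : |A a.1 a.2 - θ * roundMatrix θ A a| ≤ √θ * √|A a.1 a.2| := by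
  have h : |A a.1 a.2 / θ - roundMatrix θ A a| ≤ √|A a.1 a.2 / θ| :=
    (exists_int_abs_le_abs_sub_le_sqrt (A a.1 a.2 / θ)).choose_spec.2
  have h1 : A a.1 a.2 - θ * roundMatrix θ A a = θ * (A a.1 a.2 / θ - roundMatrix θ A a) := by
    field_simp
  rw [h1, abs_mul, abs_of_pos hθ]
  refine (mul_le_mul_of_nonneg_left h hθ.le).trans (le_of_eq ?_)
  rw [abs_div, abs_of_pos hθ, Real.sqrt_div (abs_nonneg _)]
  have := Real.mul_self_sqrt hθ.le
  have h0 : √θ ≠ 0 := (Real.sqrt_pos.2 hθ).ne'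
  field_simp
  rw [pow_two, this, mul_comm]

/-- The matrix `θ • Z` for an integer matrix `Z`. -/
noncomputable def scaledMatrix {k l : ℕ} (θ : ℝ) (z : Fin k × Fin l → ℤ) : Matrix (Fin k) (Fin l) ℝ :=
  Matrix.of fun a b => θ * z (a, b)

theorem l1Norm_col_scaledMatrix_le {k l : ℕ} {θ : ℝ} (hθ : 0 < θ) (A : Matrix (Fin k) (Fin l) ℝ)
    (i : Fin l) : l1Norm ((scaledMatrix θ (roundMatrix θ A)).col i) ≤ l1Norm (A.col i) := by
  refine Finset.sum_le_sum fun a _ => ?_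
  simp only [scaledMatrix, Matrix.col_apply, Matrix.of_apply, abs_mul, abs_of_pos hθ]
  exact mul_abs_roundMatrix_le hθ A (a, i)

/-- The entrywise errors `√θ * √|a|` sum to `√θ` times the square root of the `ℓ_{1/2}` quasinorm,
which effective sparsity bounds by `√s`. -/
theorem l1Norm_col_sub_scaledMatrix_le {k l : ℕ} {θ s : ℝ} (hθ : 0 < θ)
    (A : Matrix (Fin k) (Fin l) ℝ) (i : Fin l) (h1 : l1Norm (A.col i) ≤ 1)
    (h : EffSparse s (A.col i)) :
    l1Norm ((A - scaledMatrix θ (roundMatrix θ A)).col i) ≤ √(θ * s) := by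
  have hs : 0 ≤ s := zero_le_one.trans h.1.1
  have h2 : ∑ a, √|A a i| ≤ √s := by
    refine Real.le_sqrt_of_sq_le (h.2.trans ?_)
    exact (mul_le_mul_of_nonneg_left h1 hs).trans (mul_one s).le
  rw [Real.sqrt_mul hθ.le]
  refine le_trans ?_ (mul_le_mul_of_nonneg_left h2 (Real.sqrt_nonneg _))
  rw [Finset.mul_sum]
  exact Finset.sum_le_sum fun a _ => abs_sub_mul_roundMatrix_le hθ A (a, i)

theorem sum_abs_roundMatrix_le {k l : ℕ} {θ : ℝ} (hθ : 0 < θ) (A : Matrix (Fin k) (Fin l) ℝ) :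
    (((∑ a, |roundMatrix θ A a| : ℤ)) : ℝ) ≤ norm11 A / θ := by
  rw [le_div_iff₀ hθ]
  push_cast
  rw [Finset.sum_mul, Fintype.sum_prod_type_right]
  refine Finset.sum_le_sum fun b _ => Finset.sum_le_sum fun a _ => ?_
  rw [mul_comm]
  exact mul_abs_roundMatrix_le hθ A (a, b)

open Classical in
/-- The networks whose `j`-th matrix is `θ j` times an integer matrix of `ℓ₁`-norm at most `M`. -/
noncomputable def gridWeights {d : ℕ} (n : Fin (d + 1) → ℕ) (θ : Fin d → ℝ) (M : ℕ) : Finset (Weights n) :=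
  (Finset.univ : Finset ((j : Fin d) → Fin M →
    Option ((Fin (n j.castSucc) × Fin (n j.succ)) × Bool))).image
    fun w j => scaledMatrix (θ j) (∑ t, signedUnit (w j t))

theorem mem_gridWeights {d : ℕ} {n : Fin (d + 1) → ℕ} {θ : Fin d → ℝ} {M : ℕ}
    (z : (j : Fin d) → Fin (n j.castSucc) × Fin (n j.succ) → ℤ) (hz : ∀ j, ∑ a, |z j a| ≤ M) :
    (fun j => scaledMatrix (θ j) (z j)) ∈ gridWeights n θ M := by
  choose w hw using fun j => exists_sum_signedUnit_eq M (z j) (hz j)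
  refine Finset.mem_image.2 ⟨w, Finset.mem_univ _, ?_⟩
  ext j : 1
  rw [← hw j]

/-- Each of the `d * M` summands is zero or a signed matrix unit, so the widths enter the
log-cardinality only logarithmically. -/
theorem card_gridWeights_le {d : ℕ} (n : Fin (d + 1) → ℕ) (θ : Fin d → ℝ) (M : ℕ) :
    (gridWeights n θ M).card ≤ (2 * maxWidth n ^ 2 + 1) ^ (d * M) := by
  classical
  refine Finset.card_image_le.trans ?_
  rw [Finset.card_univ, Fintype.card_pi, mul_comm d, pow_mul]
  refine (Finset.prod_le_pow_card _ _ ((2 * maxWidth n ^ 2 + 1) ^ M) fun j _ => ?_).trans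
    (by simp)
  simp only [Fintype.card_pi, Fintype.card_option, Fintype.card_prod, Fintype.card_fin,
    Fintype.card_bool, Finset.prod_const, Finset.card_univ]
  refine Nat.pow_le_pow_left (Nat.succ_le_succ ?_) M
  rw [mul_comm, pow_two]
  refine Nat.mul_le_mul_left 2 ?_
  have h : ∀ i, n i ≤ maxWidth n := fun i => Finset.le_sup (Finset.mem_univ i)
  exact Nat.mul_le_mul (h _) (h _)

end AdvNet

/-! ### Concentration and the union bound. -/

/-- One-sided Hoeffding inequality for the empirical frequency of an event. -/
theorem measure_pi_empirical_frequency_le {Ω : Type*} [MeasurableSpace Ω] (D : Measure Ω)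
    [IsProbabilityMeasure D] {s : Set Ω} (hs : MeasurableSet s) {m : ℕ} (hm : 0 < m) {t : ℝ}
    (ht : 0 ≤ t) :
    (Measure.pi fun _ : Fin m => D)
      {S | (1 / (m : ℝ)) * ∑ i, s.indicator (fun _ => (1 : ℝ)) (S i) + t ≤ D.real s} ≤
      ENNReal.ofReal (Real.exp (-2 * m * t ^ 2)) := by
  set P := Measure.pi fun _ : Fin m => D
  have hm' : (0 : ℝ) < m := by exact_mod_cast hm
  set X : Fin m → Ω → ℝ := fun _ z => D.real s - s.indicator (fun _ => (1 : ℝ)) z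
  have hX : Measurable (fun z => D.real s - s.indicator (fun _ => (1 : ℝ)) z) :=
    measurable_const.sub (measurable_const.indicator hs)
  have hind : iIndepFun (fun i (S : Fin m → Ω) => X i (S i)) P :=
    iIndepFun_pi fun _ => hX.aemeasurable
  have hsub : HasSubgaussianMGF (fun z => D.real s - s.indicator (fun _ => (1 : ℝ)) z)
      (1 / 4) D := by
    -- Hoeffding's lemma on an interval of length 1 gives the parameter `(1 / 2) ^ 2`.
    have hc : (‖D.real s - (D.real s - 1)‖₊ / 2) ^ 2 = 1 / 4 := by
      rw [sub_sub_cancel, nnnorm_one]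
      norm_num
    rw [← hc]
    refine hasSubgaussianMGF_of_mem_Icc_of_integral_eq_zero hX.aemeasurable ?_ ?_
    · refine Filter.Eventually.of_forall fun z => ?_
      by_cases hz : z ∈ s <;> simp [hz]
    · rw [integral_sub (integrable_const _) ((integrable_const _).indicator hs),
        integral_indicator hs]
      simp
  have hsubi : ∀ i ∈ (Finset.univ : Finset (Fin m)),
      HasSubgaussianMGF (fun S : Fin m → Ω => X i (S i)) (1 / 4) P := by
    intro i _
    have hmp := measurePreserving_eval (fun _ : Fin m => D) i
    have hsub' : HasSubgaussianMGF (fun z => D.real s - s.indicator (fun _ => (1 : ℝ)) z) (1 / 4)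
        (P.map (Function.eval i)) := by
      rwa [hmp.map_eq]
    exact HasSubgaussianMGF.of_map (Y := Function.eval i) hmp.measurable.aemeasurable hsub'
  have h := HasSubgaussianMGF.measure_sum_ge_le_of_iIndepFun hind hsubi
    (mul_nonneg hm'.le ht)
  have hset : {S : Fin m → Ω | (1 / (m : ℝ)) * ∑ i, s.indicator (fun _ => (1 : ℝ)) (S i) + t ≤
      D.real s} = {S | (m : ℝ) * t ≤ ∑ i, X i (S i)} := by
    ext S
    simp only [Set.mem_ofPred_eq, X, Finset.sum_sub_distrib, Finset.sum_const, Finset.card_univ,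
      Fintype.card_fin, nsmul_eq_mul]
    rw [← mul_le_mul_iff_right₀ hm', mul_add, ← mul_assoc, mul_one_div_cancel hm'.ne', one_mul,
      le_sub_iff_add_le']
  rw [hset, ← ofReal_measureReal]
  refine ENNReal.ofReal_le_ofReal (h.trans (le_of_eq ?_))
  congr 1
  simp
  field_simp
  norm_num

namespace AdvNet

/-- The generalization bound for a compression map into a finite class, by the union bound. -/
theorem measure_generalization_bound_le {d : ℕ} {n : Fin (d + 1) → ℕ} (hK : 2 ≤ n (Fin.last d))
    {γ ε : ℝ} {A : Finset (Weights n)} {compress : Weights n → Weights n} {Q : Weights n → Prop}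
    (hA : ∀ W, Q W → compress W ∈ A ∧
      ∀ (x : Fin (n 0) → ℝ) (y : Fin (n (Fin.last d))), ‖x‖ ≤ 1 →
        |advMargin ε (network W) x y - advMargin ε (network (compress W)) x y| ≤ γ)
    (D : Measure ((Fin (n 0) → ℝ) × Fin (n (Fin.last d)))) [IsProbabilityMeasure D]
    (hD : ∀ᵐ z ∂D, ‖z.1‖ ≤ 1) {m : ℕ} (hm : 0 < m) {t : ℝ} (ht : 0 ≤ t) :
    (Measure.pi fun _ : Fin m => D)
      {S | ¬ ∀ W, Q W → advLoss D 0 ε (network (compress W)) ≤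
        empAdvLoss S γ ε (network W) + t} ≤
      ENNReal.ofReal (A.card * Real.exp (-2 * m * t ^ 2)) := by
  set P := Measure.pi fun _ : Fin m => D
  have hS : ∀ᵐ S ∂P, ∀ i, ‖(S i).1‖ ≤ 1 := by
    rw [ae_all_iff]
    exact fun i => (Measure.quasiMeasurePreserving_eval (fun _ : Fin m => D) i).ae hD
  -- The bad event over all `W` lies, up to a null set, in a finite union over `A`, so its own
  -- measurability is not needed.
  have hsub : P {S | ¬ ∀ W, Q W → advLoss D 0 ε (network (compress W)) ≤
        empAdvLoss S γ ε (network W) + t} ≤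
      P (⋃ V ∈ A, {S | empAdvLoss S 0 ε (network V) + t ≤ advLoss D 0 ε (network V)}) := by
    refine measure_mono_ae ?_
    filter_upwards [hS] with S hS1 hS2
    obtain ⟨W, hW, hlt⟩ : ∃ W, Q W ∧ empAdvLoss S γ ε (network W) + t <
        advLoss D 0 ε (network (compress W)) := by
      simpa using (show ¬ _ from hS2)
    refine Set.mem_iUnion₂.2 ⟨compress W, (hA W hW).1, ?_⟩
    refine le_trans (add_le_add_left ?_ _) hlt.le
    refine mul_le_mul_of_nonneg_left (Finset.sum_le_sum fun i _ => ?_) (by positivity)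
    have h := abs_le.1 ((hA W hW).2 (S i).1 (S i).2 (hS1 i))
    -- A compressed margin at most `0` forces an original margin at most `γ`, so the indicators
    -- compare termwise.
    by_cases h0 : advMargin ε (network (compress W)) (S i).1 (S i).2 ≤ 0
    · have hγ : advMargin ε (network W) (S i).1 (S i).2 ≤ γ := by linarith [h.2]
      simp [Set.indicator, h0, hγ]
    · simp only [Set.indicator, Set.mem_ofPred_eq, h0, if_false]
      split_ifs <;> norm_num
  refine hsub.trans ((measure_biUnion_finset_le _ _).trans ?_)
  have h1 : ∀ V ∈ A, P {S | empAdvLoss S 0 ε (network V) + t ≤ advLoss D 0 ε (network V)} ≤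
      ENNReal.ofReal (Real.exp (-2 * m * t ^ 2)) := fun V _ =>
    measure_pi_empirical_frequency_le D
      (measurableSet_le (measurable_advMargin hK (continuous_network V) ε) measurable_const) hm ht
  refine (Finset.sum_le_sum h1).trans (le_of_eq ?_)
  rw [Finset.sum_const, nsmul_eq_mul, ENNReal.ofReal_mul (by positivity), ENNReal.ofReal_natCast]

end AdvNet

namespace AdvNet

/-! ### Choice of scales and the resulting bounds. -/

theorem sqrt_mul_le_sum {d : ℕ} (s₁ s₂ : Fin d → ℝ) (j : Fin d) :
    √(s₁ j * s₂ j) ≤ ∑ j, √(s₁ j * s₂ j) :=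
  Finset.single_le_sum (f := fun j => √(s₁ j * s₂ j)) (fun _ _ => Real.sqrt_nonneg _)
    (Finset.mem_univ j)

theorem one_le_sum_sqrt {d : ℕ} {s₁ s₂ : Fin d → ℝ} (h₁ : ∀ j, 1 ≤ s₁ j) (h₂ : ∀ j, 1 ≤ s₂ j)
    (j : Fin d) : 1 ≤ ∑ j, √(s₁ j * s₂ j) :=
  (Real.one_le_sqrt.2 (one_le_mul_of_one_le_of_one_le (h₁ j) (h₂ j))).trans
    (sqrt_mul_le_sum s₁ s₂ j)

/-- Joint sparsity forces a positive number of columns, so there is a column from which to read off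
the bound. -/
theorem Admissible.one_le_left {d : ℕ} {n : Fin (d + 1) → ℕ} {s₁ s₂ : Fin d → ℝ} {W : Weights n}
    (hW : Admissible s₁ s₂ W) (j : Fin d) : 1 ≤ s₁ j := by
  have h : (1 : ℝ) ≤ n j.succ := (hW j).2.2.1.1.trans (hW j).2.2.1.2
  exact ((hW j).2.1 ⟨0, by exact_mod_cast h⟩).1.1

theorem Admissible.one_le_right {d : ℕ} {n : Fin (d + 1) → ℕ} {s₁ s₂ : Fin d → ℝ} {W : Weights n}
    (hW : Admissible s₁ s₂ W) (j : Fin d) : 1 ≤ s₂ j :=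
  (hW j).2.2.1.1

/-- Rounding every weight matrix to a multiple of `θ j`. -/
noncomputable def roundWeights {d : ℕ} {n : Fin (d + 1) → ℕ} (θ : Fin d → ℝ) (W : Weights n) :
    Weights n :=
  fun j => scaledMatrix (θ j) (roundMatrix (θ j) (W j))

theorem Admissible.l1Norm_col_le {d : ℕ} {n : Fin (d + 1) → ℕ} {s₁ s₂ : Fin d → ℝ}
    {W : Weights n} (hW : Admissible s₁ s₂ W) (j : Fin d) (i : Fin (n j.succ)) :
    l1Norm ((W j).col i) ≤ 1 :=
  (l1Norm_col_le_norm1Inf _ _).trans (hW j).1.le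

/-- The scale `s₂ j / B` gives every layer the same budget `B`. Positivity is asked only per layer,
since for `d = 0` the `B` used later vanishes. -/
theorem roundWeights_mem_gridWeights {d : ℕ} {n : Fin (d + 1) → ℕ} {s₁ s₂ : Fin d → ℝ}
    {W : Weights n} (hW : Admissible s₁ s₂ W) {B : ℝ} (hB : ∀ _ : Fin d, 0 < B) :
    roundWeights (fun j => s₂ j / B) W ∈ gridWeights n (fun j => s₂ j / B) ⌊B⌋₊ := by
  refine mem_gridWeights _ fun j => ?_
  have hs : 0 < s₂ j := zero_lt_one.trans_le (hW.one_le_right j)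
  have hB := hB j
  rw [Int.natCast_floor_eq_floor hB.le]
  refine Int.le_floor.2 ((sum_abs_roundMatrix_le (div_pos hs hB) (W j)).trans ?_)
  have h := (hW j).2.2.2
  rw [(hW j).1, mul_one] at h
  rw [div_le_iff₀ (div_pos hs hB), mul_div_cancel₀ _ hB.ne']
  exact h

theorem norm_network_sub_roundWeights_le {d : ℕ} {n : Fin (d + 1) → ℕ} {s₁ s₂ : Fin d → ℝ}
    {W : Weights n} (hW : Admissible s₁ s₂ W) {R : ℝ} (hR : 0 < R) (x : Fin (n 0) → ℝ) :
    ‖network W x - network (roundWeights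
      (fun j => s₂ j / (R * ∑ j, √(s₁ j * s₂ j)) ^ 2) W) x‖ ≤ ‖x‖ / R := by
  set σ := ∑ j, √(s₁ j * s₂ j) with hσ
  have hσ0 : ∀ _ : Fin d, 0 < σ := fun j =>
    zero_lt_one.trans_le (one_le_sum_sqrt hW.one_le_left hW.one_le_right j)
  have hs₁ : ∀ j, 0 < s₁ j := fun j => zero_lt_one.trans_le (hW.one_le_left j)
  have hs₂ : ∀ j, 0 < s₂ j := fun j => zero_lt_one.trans_le (hW.one_le_right j)
  have hθ : ∀ j, 0 < s₂ j / (R * σ) ^ 2 := fun j =>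
    div_pos (hs₂ j) (pow_pos (mul_pos hR (hσ0 j)) 2)
  have hτ : ∀ j, √(s₂ j / (R * σ) ^ 2 * s₁ j) = √(s₁ j * s₂ j) / (R * σ) := by
    intro j
    rw [div_mul_eq_mul_div, mul_comm (s₂ j), Real.sqrt_div (mul_pos (hs₁ j) (hs₂ j)).le,
      Real.sqrt_sq (mul_pos hR (hσ0 j)).le]
  refine (norm_network_sub_network_le (τ := fun j => √(s₁ j * s₂ j) / (R * σ)) hW.l1Norm_col_le
    (fun j i => (l1Norm_col_scaledMatrix_le (hθ j) (W j) i).trans (hW.l1Norm_col_le j i))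
    (fun j i => ?_) (fun j => ?_) x).trans ?_
  · rw [← hτ j]
    exact l1Norm_col_sub_scaledMatrix_le (hθ j) (W j) i (hW.l1Norm_col_le j i) ((hW j).2.1 i)
  · exact div_nonneg (Real.sqrt_nonneg _) (mul_pos hR (hσ0 j)).le
  · rw [← Finset.sum_div, ← hσ, div_eq_mul_one_div ‖x‖]
    refine mul_le_mul_of_nonneg_left ?_ (norm_nonneg _)
    rw [mul_comm R, ← div_div]
    -- The inequality `σ / σ ≤ 1` also covers `σ = 0`, which occurs for `d = 0`.
    exact div_le_div_of_nonneg_right (div_self_le_one σ) hR.le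

theorem abs_advMargin_roundWeights_le {d : ℕ} {n : Fin (d + 1) → ℕ} (hK : 2 ≤ n (Fin.last d))
    {s₁ s₂ : Fin d → ℝ} {W : Weights n} (hW : Admissible s₁ s₂ W) {R γ ε : ℝ} (hR : 0 < R)
    (hε : 0 ≤ ε) (hRγ : 2 * (1 + ε) ≤ γ * R) (x : Fin (n 0) → ℝ) (hx : ‖x‖ ≤ 1)
    (y : Fin (n (Fin.last d))) :
    |advMargin ε (network W) x y - advMargin ε (network (roundWeights
      (fun j => s₂ j / (R * ∑ j, √(s₁ j * s₂ j)) ^ 2) W)) x y| ≤ γ := by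
  refine abs_advMargin_sub_advMargin_le hK (continuous_network _) (continuous_network _) hε x y
    fun η hη => ?_
  have h1 := norm_network_sub_roundWeights_le hW hR (x + η)
  have h2 : ‖x + η‖ ≤ 1 + ε := (norm_add_le _ _).trans (add_le_add hx hη)
  rw [le_div_iff₀ hR] at h1
  refine le_of_mul_le_mul_right ?_ hR
  linarith

theorem capacity_nonneg {d : ℕ} (s₁ s₂ : Fin d → ℝ) (γ ε : ℝ) : 0 ≤ capacity s₁ s₂ γ ε := by
  unfold capacity
  positivity

theorem logFactor_nonneg {d : ℕ} (n : Fin (d + 1) → ℕ) (s₁ s₂ : Fin d → ℝ) (γ ε : ℝ) :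
    0 ≤ logFactor n s₁ s₂ γ ε := by
  have := mul_nonneg (Nat.cast_nonneg (α := ℝ) (maxWidth n)) (capacity_nonneg s₁ s₂ γ ε)
  exact Real.log_nonneg (by linarith)

theorem card_gridWeights_le_exp {d : ℕ} (n : Fin (d + 1) → ℕ) {s₁ s₂ : Fin d → ℝ}
    (h₁ : ∀ j, 1 ≤ s₁ j) (h₂ : ∀ j, 1 ≤ s₂ j) {γ ε : ℝ}
    (hR : 1 ≤ (1 + γ / 2 - ε) / (γ / 2 - 2 * ε)) (θ : Fin d → ℝ) :
    ((gridWeights n θ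
      ⌊((1 + γ / 2 - ε) / (γ / 2 - 2 * ε) * ∑ j, √(s₁ j * s₂ j)) ^ 2⌋₊).card : ℝ) ≤
      Real.exp (3 * (capacity s₁ s₂ γ ε * logFactor n s₁ s₂ γ ε)) := by
  set R := (1 + γ / 2 - ε) / (γ / 2 - 2 * ε) with hRdef
  set σ := ∑ j, √(s₁ j * s₂ j) with hσ
  set M := ⌊(R * σ) ^ 2⌋₊
  set T := capacity s₁ s₂ γ ε with hT
  set Λ := logFactor n s₁ s₂ γ ε with hΛ
  have hTeq : T = d * (R * σ) ^ 2 := by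
    rw [hT, capacity, ← hRdef, ← hσ]
    ring
  have hΛ0 : 0 ≤ Λ := logFactor_nonneg ..
  have hT0 : 0 ≤ T := capacity_nonneg ..
  have hMT : ((d * M : ℕ) : ℝ) ≤ T := by
    rw [hTeq, Nat.cast_mul]
    exact mul_le_mul_of_nonneg_left (Nat.floor_le (sq_nonneg _)) (Nat.cast_nonneg _)
  have hcard : ((gridWeights n θ M).card : ℝ) ≤ (2 * (maxWidth n : ℝ) ^ 2 + 1) ^ (d * M) := by
    exact_mod_cast card_gridWeights_le n θ M
  refine hcard.trans ?_
  rcases Nat.eq_zero_or_pos d with rfl | hd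
  · simp only [zero_mul, pow_zero]
    exact Real.one_le_exp (by positivity)
  have hσ1 : 1 ≤ σ := one_le_sum_sqrt h₁ h₂ ⟨0, hd⟩
  have hT1 : 1 ≤ T := by
    rw [hTeq]
    have hd1 : (1 : ℝ) ≤ d := by exact_mod_cast hd
    exact one_le_mul_of_one_le_of_one_le hd1
      (one_le_pow₀ (one_le_mul_of_one_le_of_one_le hR hσ1))
  set N : ℝ := (maxWidth n : ℝ)
  have hN : 0 ≤ N := Nat.cast_nonneg _
  -- Here `T ≥ 1` is what lets `Λ` control the width.
  have hNT : 2 + N ≤ Real.exp Λ := by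
    rw [hΛ, logFactor, Real.exp_log (by positivity)]
    nlinarith
  -- The factor 3 comes from `2 * N ^ 2 + 1 ≤ (2 + N) ^ 3`.
  have hbase : 2 * N ^ 2 + 1 ≤ Real.exp (3 * Λ) := by
    have : Real.exp (3 * Λ) = Real.exp Λ ^ 3 := by
      rw [← Real.exp_nat_mul]
      norm_num
    rw [this]
    refine le_trans ?_ (pow_le_pow_left₀ (by positivity) hNT 3)
    nlinarith [pow_nonneg hN 3, pow_nonneg hN 2]
  refine (pow_le_pow_left₀ (by positivity) hbase _).trans ?_
  rw [← Real.exp_nat_mul]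
  refine Real.exp_le_exp.2 ?_
  nlinarith [mul_le_mul_of_nonneg_right hMT hΛ0]

/-- Dropping the cross term of the square leaves the exponent at most `3 * a - 2 * (4 * a + log (1 /
δ)) ≤ log δ`. -/
theorem mul_exp_neg_sq_le {c a m δ : ℝ} (ha : 0 ≤ a) (hm : 0 < m) (hδ : 0 < δ) (hδ1 : δ < 1)
    (hc : c ≤ Real.exp (3 * a)) :
    c * Real.exp (-2 * m * (2 * √(a / m) + √(Real.log (1 / δ) / m)) ^ 2) ≤ δ := by
  have hlog : 0 < Real.log (1 / δ) := Real.log_pos (by rw [lt_div_iff₀ hδ]; linarith)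
  have h1 := Real.sq_sqrt (div_nonneg ha hm.le)
  have h2 := Real.sq_sqrt (div_nonneg hlog.le hm.le)
  have h3 : a / m * m = a := div_mul_cancel₀ _ hm.ne'
  have h4 : Real.log (1 / δ) / m * m = Real.log (1 / δ) := div_mul_cancel₀ _ hm.ne'
  have h5 : 4 * a + Real.log (1 / δ) ≤
      m * (2 * √(a / m) + √(Real.log (1 / δ) / m)) ^ 2 := by
    have : m * (2 * √(a / m) + √(Real.log (1 / δ) / m)) ^ 2 = 4 * a + Real.log (1 / δ) +
        m * (4 * (√(a / m) * √(Real.log (1 / δ) / m))) := by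
      linear_combination 4 * m * h1 + m * h2 + 4 * h3 + h4
    rw [this]
    have : 0 ≤ m * (4 * (√(a / m) * √(Real.log (1 / δ) / m))) := by positivity
    linarith
  refine (mul_le_mul_of_nonneg_right hc (Real.exp_pos _).le).trans ?_
  rw [← Real.exp_add]
  calc _ ≤ Real.exp (Real.log δ) := Real.exp_le_exp.2 ?_
    _ = δ := Real.exp_log hδ
  have h6 : Real.log (1 / δ) = -Real.log δ := by rw [one_div, Real.log_inv]
  linarith

end AdvNet

/-! ### The generalization bound. -/

theorem theorem3 :
    ∃ C : ℝ, 0 < C ∧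
      ∀ (d : ℕ) (n : Fin (d + 1) → ℕ), 2 ≤ n (Fin.last d) →
      ∀ (s₁ s₂ : Fin d → ℝ) (γ ε : ℝ), 0 < γ → 0 ≤ ε → ε < γ / 4 →
      -- a finite class of networks and a compression map, both independent of the data
      ∃ (A : Finset (AdvNet.Weights n)) (compress : AdvNet.Weights n → AdvNet.Weights n),
        (∀ W : AdvNet.Weights n, AdvNet.Admissible s₁ s₂ W →
          compress W ∈ A ∧
          ∀ (x : Fin (n 0) → ℝ) (y : Fin (n (Fin.last d))), ‖x‖ ≤ 1 →
            |AdvNet.advMargin ε (AdvNet.network W) x y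
              - AdvNet.advMargin ε (AdvNet.network (compress W)) x y| ≤ γ) ∧
        ∀ (D : Measure ((Fin (n 0) → ℝ) × Fin (n (Fin.last d)))) [IsProbabilityMeasure D],
          (∀ᵐ z ∂D, ‖z.1‖ ≤ 1) →
          ∀ (m : ℕ), 0 < m → ∀ (δ : ℝ), 0 < δ → δ < 1 →
            -- the bound fails for some admissible network with probability at most `δ`
            (Measure.pi fun _ : Fin m => D)
              {S | ¬ ∀ W : AdvNet.Weights n, AdvNet.Admissible s₁ s₂ W →
                AdvNet.advLoss D 0 ε (AdvNet.network (compress W)) ≤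
                  AdvNet.empAdvLoss S γ ε (AdvNet.network W)
                    + C * √(AdvNet.capacity s₁ s₂ γ ε * AdvNet.logFactor n s₁ s₂ γ ε / m)
                    + √(Real.log (1 / δ) / m)} ≤ ENNReal.ofReal δ := by

  refine ⟨2, two_pos, fun d n hK s₁ s₂ γ ε hγ hε hεγ => ?_⟩
  -- The bounds `1 ≤ s₁ j` and `1 ≤ s₂ j` used in the cardinality estimate come from an admissible
  -- `W`; without one the bad event is empty.
  by_cases hne : ∃ W : AdvNet.Weights n, AdvNet.Admissible s₁ s₂ W
  · obtain ⟨W₀, hW₀⟩ := hne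
    set R := (1 + γ / 2 - ε) / (γ / 2 - 2 * ε) with hRdef
    have hden : 0 < γ / 2 - 2 * ε := by linarith
    have hR : 1 ≤ R := (one_le_div hden).2 (by linarith)
    have hR0 : 0 < R := zero_lt_one.trans_le hR
    have hRγ : 2 * (1 + ε) ≤ γ * R := by
      rw [hRdef, mul_div_assoc', le_div_iff₀ hden]
      -- The difference of the two sides is `γ * (γ / 2 - 2 * ε) + 4 * ε + 4 * ε ^ 2`.
      nlinarith [mul_nonneg hε hε, mul_nonneg hγ.le hε]
    set θ : Fin d → ℝ := fun j => s₂ j / (R * ∑ j, √(s₁ j * s₂ j)) ^ 2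
    have hA : ∀ W : AdvNet.Weights n, AdvNet.Admissible s₁ s₂ W →
        AdvNet.roundWeights θ W ∈
          AdvNet.gridWeights n θ ⌊(R * ∑ j, √(s₁ j * s₂ j)) ^ 2⌋₊ ∧
        ∀ (x : Fin (n 0) → ℝ) (y : Fin (n (Fin.last d))), ‖x‖ ≤ 1 →
          |AdvNet.advMargin ε (AdvNet.network W) x y
            - AdvNet.advMargin ε (AdvNet.network (AdvNet.roundWeights θ W)) x y| ≤ γ :=
      fun W hW => ⟨AdvNet.roundWeights_mem_gridWeights hW fun j =>
          pow_pos (mul_pos hR0 (zero_lt_one.trans_le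
            (AdvNet.one_le_sum_sqrt hW.one_le_left hW.one_le_right j))) 2,
        fun x y hx => AdvNet.abs_advMargin_roundWeights_le hK hW hR0 hε hRγ x hx y⟩
    refine ⟨_, AdvNet.roundWeights θ, hA, fun D _ hD m hm δ hδ hδ1 => ?_⟩
    have h := AdvNet.measure_generalization_bound_le hK hA D hD hm
      (t := 2 * √(AdvNet.capacity s₁ s₂ γ ε * AdvNet.logFactor n s₁ s₂ γ ε / m)
        + √(Real.log (1 / δ) / m)) (by positivity)
    simp only [← add_assoc] at h
    refine h.trans (ENNReal.ofReal_le_ofReal ?_)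
    exact AdvNet.mul_exp_neg_sq_le
      (mul_nonneg (AdvNet.capacity_nonneg ..) (AdvNet.logFactor_nonneg ..))
      (by exact_mod_cast hm) hδ hδ1
      (AdvNet.card_gridWeights_le_exp n hW₀.one_le_left hW₀.one_le_right hR θ)
  · have hno : ∀ W : AdvNet.Weights n, ¬ AdvNet.Admissible s₁ s₂ W := not_exists.1 hne
    refine ⟨∅, id, fun W hW => absurd hW (hno W), fun D _ _ m _ δ _ _ => ?_⟩
    simp [hno]
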